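/- Let $\Gamma$ be a finite simple graph with vertex set $X$, $|X|=k$, and let $G=G(\Gamma)=\langle X\mid [x,y]=1 \text{ if } x,y \text{ are adjacent in } \Gamma\rangle$ be its partially commutative group. For $Y\subseteq X$ let $G(Y)$ be the subgroup of $G$ generated by $Y$, let $Y^\perp=\{u\in X : d(u,y)\le 1 \text{ for all } y\in Y\}$ and $\operatorname{cl}(Y)=Y^{\perp\perp}$; let $L$ be the set of all $Y\subseteq X$ with $Y=\operatorname{cl}(Y)$. For $x,y\in X$ write $\operatorname{cl}(x)=\operatorname{cl}(\{x\})$, $x^\perp=\{x\}^\perp$, write $x\sim y$ if $x^\perp=y^\perp$, and $x<_L y$ if $\operatorname{cl}(x)\subsetneq\operatorname{cl}(y)$; let $L^{\max}$ be the set of all $\operatorname{cl}(x)$ with $x$ maximal for $<_L$. Automorphisms of $G$ are written on the right (so in $\phi\psi$ the map $\phi$ is applied first). Put \[\operatorname{St}(L)=\{\phi\in\operatorname{Aut}(G): G(Y)^\phi=G(Y)\ \forall\, Y\in L\},\qquad \operatorname{St}(L^{\max})=\{\phi\in\operatorname{Aut}(G): G(Y)^\phi=G(Y)\ \forall\, Y\in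 L^{\max}\}.\] A group is called arithmetic if, for some $n$ and some subgroup $H\le \operatorname{GL}(n,\mathbb C)$ defined by polynomials with rational coefficients, it is isomorphic to a subgroup of $H\cap\operatorname{GL}(n,\mathbb Q)$ that is commensurable with $H\cap\operatorname{GL}(n,\mathbb Z)$. Then: 1. $\operatorname{St}(L^{\max})$ is an arithmetic group, and $\operatorname{St}(L)\le\operatorname{St}(L^{\max})$. 2. There is an enumeration $X=\{x_1,\dots,x_k\}$ such that (a) $x_i<_L x_j$ implies $j<i$, and (b) if $i<j<l$ and $x_i\sim x_l$ then $x_j\sim x_l$. For every such enumeration there is an injective homomorphism $\pi:\operatorname{St}(L^{\max})\to\operatorname{GL}(k,\mathbb Z)$, $\phi\mapsto[\phi]=(a_{i,j})$, with $x_i^\phi=x_1^{a_{i,1}}\cdots x_k^{a_{i,k}}$ for $i=1,\dots,k$. The image of $\operatorname{St}(L)$ under $\pi$ is the set $S_X$ of all integer $k\times k$ matrices $A=(a_{i,j})$ such that: for each class of $\sim$, the diagonal block of $A$ on the indices $i$ with $x_i$ in this class is invertible over $\mathbb Z$; if $i>j$ and $x_i\not\sim x_j$ then $a_{i,j}=0$;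 and if $i<j$ and $x_i\not\sim x_j$ then $a_{i,j}=0$ unless $x_j<_L x_i$. Moreover $S_X$ has finite index in the image of $\operatorname{St}(L^{\max})$ under $\pi$. -/

import Mathlib

open scoped MatrixGroups

/-! ### Arithmetic groups -/

section Arithmetic

/-- The matrices with integer entries (and integer inverse) inside `GL(n, ℂ)`. -/
noncomputable def integralPoints (n : ℕ) : Subgroup (GL (Fin n) ℂ) :=
  (Matrix.GeneralLinearGroup.map (n := Fin n) (Int.castRingHom ℂ)).range

/-- The matrices with rational entries inside `GL(n, ℂ)`. -/
noncomputable def rationalPoints (n : ℕ) : Subgroup (GL (Fin n) ℂ) :=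
  (Matrix.GeneralLinearGroup.map (n := Fin n) (algebraMap ℚ ℂ)).range

/-- A subgroup `H` of `GL(n, ℂ)` is a `ℚ`-defined linear algebraic group if it is cut out in
`GL(n, ℂ)` by polynomials with rational coefficients in the matrix entries.  (Multiplication and
inversion of matrices are then automatically morphisms defined over `ℚ`.) -/
def IsRationallyDefined {n : ℕ} (H : Subgroup (GL (Fin n) ℂ)) : Prop :=
  ∃ P : Set (MvPolynomial (Fin n × Fin n) ℚ), ∀ g : GL (Fin n) ℂ,
    g ∈ H ↔ ∀ p ∈ P, MvPolynomial.aeval (fun ij : Fin n × Fin n => g.val ij.1 ij.2) p = 0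

/-- `A` is an arithmetic subgroup of `H ≤ GL(n, ℂ)`: it consists of rational points of `H` and is
commensurable with `H ∩ GL(n, ℤ)`. -/
def IsArithmeticSubgroupOf {n : ℕ} (A H : Subgroup (GL (Fin n) ℂ)) : Prop :=
  A ≤ H ⊓ rationalPoints n ∧ Subgroup.Commensurable A (H ⊓ integralPoints n)

/-- An abstract group is arithmetic if it is isomorphic to an arithmetic subgroup of a `ℚ`-defined
linear algebraic group. -/
def IsArithmeticGroup (S : Type*) [Group S] : Prop :=
  ∃ (n : ℕ) (H A : Subgroup (GL (Fin n) ℂ)),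
    IsRationallyDefined H ∧ IsArithmeticSubgroupOf A H ∧ Nonempty (S ≃* A)

end Arithmetic

namespace SimpleGraph

/-! ### Closed sets of a graph -/

section Closure

variable {X : Type*} (Γ : SimpleGraph X)

/-- The orthogonal complement `Y^⊥`: the vertices at distance at most `1` from all of `Y`. -/
def perp (Y : Set X) : Set X := {u | ∀ y ∈ Y, Γ.edist u y ≤ 1}

/-- The closure `cl(Y) = Y^⊥⊥`. -/
def cl (Y : Set X) : Set X := Γ.perp (Γ.perp Y)

/-- The lattice `L` of closed sets, as a set of subsets of `X`. -/
def closedSets : Set (Set X) := {Y | Γ.cl Y = Y}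

/-- `x <_L y`: the closure of `x` is strictly contained in the closure of `y`. -/
def ltL (x y : X) : Prop := Γ.cl {x} ⊂ Γ.cl {y}

/-- `x ≤_L y`: either `x <_L y` or `cl(x) = cl(y)`. -/
def leL (x y : X) : Prop := Γ.ltL x y ∨ Γ.cl {x} = Γ.cl {y}

/-- `x` is `L`-maximal. -/
def IsLMaximal (x : X) : Prop := ∀ y, Γ.leL x y → Γ.cl {y} = Γ.cl {x}

/-- `L^max`: the closures of the `L`-maximal vertices. -/
def maxClosedSets : Set (Set X) := {Y | ∃ x, Γ.IsLMaximal x ∧ Y = Γ.cl {x}}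

/-- `x ∼ y`: the vertices `x` and `y` have the same orthogonal complement. -/
def perpEquiv (x y : X) : Prop := Γ.perp {x} = Γ.perp {y}

end Closure

/-! ### Partially commutative groups and stabilisers -/

section Group

variable {X : Type*} (Γ : SimpleGraph X)

/-- The commutators `x⁻¹ y⁻¹ x y` of adjacent vertices. -/
def commRels : Set (FreeGroup X) :=
  {r | ∃ x y, Γ.Adj x y ∧
    r = (FreeGroup.of x)⁻¹ * (FreeGroup.of y)⁻¹ * FreeGroup.of x * FreeGroup.of y}

/-- The partially commutative group `G(Γ)` with commutation graph `Γ`. -/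
abbrev PCGroup : Type _ := PresentedGroup Γ.commRels

/-- The generator of `G(Γ)` given by a vertex. -/
def gen (x : X) : Γ.PCGroup := PresentedGroup.of x

/-- The canonical parabolic subgroup `G(Y)`, generated by `Y ⊆ X`. -/
def parabolic (Y : Set X) : Subgroup Γ.PCGroup := Subgroup.closure (Γ.gen '' Y)

/-- The automorphism group of `G(Γ)`, with automorphisms written on the right: in the product
`φ * ψ` the automorphism `φ` is applied first. -/
abbrev RightAut : Type _ := (MulAut Γ.PCGroup)ᵐᵒᵖ

/-- The stabiliser in `Aut(G(Γ))` of all the subgroups `G(Y)`, for `Y` in the family `F`. -/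
def stabiliser (F : Set (Set X)) : Subgroup Γ.RightAut where
  carrier := {φ | ∀ Y ∈ F, (Γ.parabolic Y).map φ.unop.toMonoidHom = Γ.parabolic Y}
  one_mem' := fun Y _ => Subgroup.map_id _
  mul_mem' := by
    intro φ ψ hφ hψ Y hY
    have h : (φ * ψ).unop.toMonoidHom = ψ.unop.toMonoidHom.comp φ.unop.toMonoidHom := rfl
    rw [h, ← Subgroup.map_map, hφ Y hY, hψ Y hY]
  inv_mem' := by
    intro φ hφ Y hY
    have h : (φ⁻¹).unop.toMonoidHom.comp φ.unop.toMonoidHom = MonoidHom.id Γ.PCGroup := by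
      ext x
      exact φ.unop.symm_apply_apply _
    conv_lhs => rw [← hφ Y hY]
    rw [Subgroup.map_map, h, Subgroup.map_id]

/-- `St(L)`. -/
def stL : Subgroup Γ.RightAut := Γ.stabiliser Γ.closedSets

/-- `St(L^max)`. -/
def stLMax : Subgroup Γ.RightAut := Γ.stabiliser Γ.maxClosedSets

end Group

/-! ### Matrices -/

section Matrices

variable {X : Type*} [Fintype X] (Γ : SimpleGraph X)

/-- An enumeration `x_1 ≺ ⋯ ≺ x_k` of the vertices, that is a total order `≺` on `X`, such that
`x <_L y` implies `y ≺ x`, and such that every equivalence class of `∼` is an interval. -/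
structure IsAdmissible (e : Fin (Fintype.card X) ≃ X) : Prop where
  lt_of_ltL : ∀ i j, Γ.ltL (e i) (e j) → j < i
  interval : ∀ i j k, i < j → j < k → Γ.perpEquiv (e i) (e k) → Γ.perpEquiv (e j) (e k)

open Classical in
/-- The set `S_X` of integer matrices.  The diagonal blocks are indexed by the classes of `∼`;
the block of the class of `x` has rows and columns the `i` with `x_i ∼ x`. -/
def blockMatrices (e : Fin (Fintype.card X) ≃ X) :
    Set (Matrix (Fin (Fintype.card X)) (Fin (Fintype.card X)) ℤ) :=
  {A |
    (∀ x : X, IsUnit ((A.submatrix (fun i : {i // Γ.perpEquiv (e i) x} => i.val)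
      (fun i : {i // Γ.perpEquiv (e i) x} => i.val)).det)) ∧
    (∀ i j, j < i → ¬ Γ.perpEquiv (e i) (e j) → A i j = 0) ∧
    (∀ i j, i < j → ¬ Γ.perpEquiv (e i) (e j) → ¬ Γ.ltL (e j) (e i) → A i j = 0)}

end Matrices

end SimpleGraph

/-!
The closure `cl(x)` of a vertex is a clique, so an automorphism `φ` in `St(L^max)` maps every vertex
`x_i` into a free abelian group `G(cl(m))`, and `φ(x_i)` is determined by its exponent sums
(`SimpleGraph.apply_gen_eq_monomial`).  The representation `π` is the action on the abelianisation
of `G(Γ)`; it is multiplicative on all of `Aut(G(Γ))` and injective on `St(L^max)`.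

*The image of `π`.*  If elements of two groups `G(C)` and `G(D)`, with `C` and `D` cliques, commute,
then the vertices that occur in one commute with those that occur in the other
(`SimpleGraph.edist_le_one_of_commute`, proved by a homomorphism to `SL(2, ℤ)`).  Hence the matrix
`A` of `φ` satisfies two conditions on its supports, called compatibility here: the `i`-th row is
supported in every member of `L^max` that contains `x_i`, and the supports of the rows of commuting
vertices commute.  Conversely these conditions make `A` the matrix of an endomorphism, and if `A⁻¹`
is compatible too, of an automorphism in `St(L^max)` (`SimpleGraph.map_autMatrix_stLMax`).

*Arithmeticity.*  Compatibility says that certain entries, and certain products of two entries,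
vanish.  The same is true for the inverse with the adjugate in its place.  Over `ℂ` this defines
an algebraic group over `ℚ`, and `St(L^max)` is isomorphic to the group of its integral points
(`SimpleGraph.isArithmeticGroup_stLMax`).

*The image of `St(L)`.*  Every closed set is the union of the closures of its members, so `St(L)`
consists of the automorphisms such that the `i`-th rows of `A` and `A⁻¹` are supported in `cl(x_i)`.
The condition on `A⁻¹` follows from the one on `A` (`SimpleGraph.inv_apply_mem_cl`), and such a
matrix is block triangular, with one diagonal block for each class of `∼`
(`SimpleGraph.isUnit_det_iff_blocks`).

*Finite index.*  There are finitely many possible supports of a matrix, and if the matrices of `φ`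
and `ψ` have the same support, then `φψ⁻¹` is in `St(L)` (`SimpleGraph.inv_apply_apply_gen_mem`).
-/

namespace SimpleGraph

/-! ### Closures of vertices -/

section Closure

variable {X : Type*} (Γ : SimpleGraph X)

theorem mem_cl_singleton {u x : X} :
    u ∈ Γ.cl {x} ↔ ∀ v, Γ.edist v x ≤ 1 → Γ.edist u v ≤ 1 := by
  simp [cl, perp]

theorem self_mem_cl (x : X) : x ∈ Γ.cl {x} :=
  Γ.mem_cl_singleton.2 fun v hv => by rwa [edist_comm]

theorem perp_anti {Y Z : Set X} (h : Y ⊆ Z) : Γ.perp Z ⊆ Γ.perp Y :=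
  fun _ hu y hy => hu y (h hy)

theorem subset_cl (Y : Set X) : Y ⊆ Γ.cl Y :=
  fun y hy u hu => by rw [edist_comm]; exact hu y hy

theorem perp_cl (Y : Set X) : Γ.perp (Γ.cl Y) = Γ.perp Y :=
  (Γ.perp_anti (Γ.subset_cl Y)).antisymm (Γ.subset_cl _)

theorem cl_mem_closedSets (Y : Set X) : Γ.cl Y ∈ Γ.closedSets := by
  change Γ.perp (Γ.perp (Γ.cl Y)) = Γ.cl Y
  rw [perp_cl, cl]

theorem cl_mono {Y Z : Set X} (h : Y ⊆ Z) : Γ.cl Y ⊆ Γ.cl Z :=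
  Γ.perp_anti (Γ.perp_anti h)

theorem cl_subset_of_mem {x y : X} (h : x ∈ Γ.cl {y}) : Γ.cl {x} ⊆ Γ.cl {y} := by
  have h' := Γ.cl_mono (Set.singleton_subset_iff.2 h)
  rwa [Γ.cl_mem_closedSets {y}] at h'

theorem mem_cl_iff_subset {x y : X} : x ∈ Γ.cl {y} ↔ Γ.cl {x} ⊆ Γ.cl {y} :=
  ⟨Γ.cl_subset_of_mem, fun h => h (Γ.self_mem_cl x)⟩

theorem perpEquiv_iff_cl_eq {x y : X} : Γ.perpEquiv x y ↔ Γ.cl {x} = Γ.cl {y} := by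
  refine ⟨fun h => ?_, fun h => ?_⟩
  · unfold cl
    rw [show Γ.perp {x} = Γ.perp {y} from h]
  · unfold perpEquiv
    rw [← Γ.perp_cl {x}, h, Γ.perp_cl]

theorem mem_cl_iff {x y : X} : x ∈ Γ.cl {y} ↔ Γ.perpEquiv y x ∨ Γ.ltL x y := by
  rw [mem_cl_iff_subset, perpEquiv_iff_cl_eq, eq_comm, ltL]
  exact le_iff_eq_or_lt

/-- Members of the closures of two vertices at distance at most `1` are at distance at most `1`.
In particular the closure of a vertex is a clique. -/
theorem edist_le_one_of_mem_cl {x y u v : X} (h : Γ.edist x y ≤ 1) (hu : u ∈ Γ.cl {x})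
    (hv : v ∈ Γ.cl {y}) : Γ.edist u v ≤ 1 := by
  rw [mem_cl_singleton] at hu hv
  exact hu v (hv x h)

theorem edist_le_one_of_mem_cl_singleton {m u v : X} (hu : u ∈ Γ.cl {m}) (hv : v ∈ Γ.cl {m}) :
    Γ.edist u v ≤ 1 :=
  Γ.edist_le_one_of_mem_cl (by simp) hu hv

theorem isLMaximal_iff {m : X} :
    Γ.IsLMaximal m ↔ ∀ y, Γ.cl {m} ⊆ Γ.cl {y} → Γ.cl {y} ⊆ Γ.cl {m} := by
  refine forall_congr' fun y => ⟨fun h hy => ?_, fun h hy => ?_⟩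
  · exact (h (lt_or_eq_of_le hy)).subset
  · rcases hy with hy | hy
    · exact absurd (h hy.1) hy.2
    · exact hy.symm

theorem exists_isLMaximal [Finite X] (x : X) : ∃ m, Γ.IsLMaximal m ∧ x ∈ Γ.cl {m} := by
  obtain ⟨_, hxM, ⟨m, rfl⟩, hm⟩ :=
    (Set.finite_range fun y => Γ.cl {y}).exists_le_maximal (Set.mem_range_self x)
  exact ⟨m, Γ.isLMaximal_iff.2 fun y hy => hm (Set.mem_range_self y) hy, hxM (Γ.self_mem_cl x)⟩

/-- The intersection of the members of `L^max` that contain `x`. -/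
def maxHull (x : X) : Set X := {y | ∀ m, Γ.IsLMaximal m → x ∈ Γ.cl {m} → y ∈ Γ.cl {m}}

theorem maxHull_trans {x y z : X} (hy : y ∈ Γ.maxHull x) (hz : z ∈ Γ.maxHull y) :
    z ∈ Γ.maxHull x :=
  fun m hm hx => hz m hm (hy m hm hx)

theorem cl_subset_maxHull (x : X) : Γ.cl {x} ⊆ Γ.maxHull x :=
  fun _ hy _ _ hx => Γ.cl_subset_of_mem hx hy

end Closure

/-! ### Exponents -/

section Exponent

variable {X : Type*} (Γ : SimpleGraph X)

theorem commute_gen {x y : X} (h : Γ.edist x y ≤ 1) : Commute (Γ.gen x) (Γ.gen y) := by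
  rcases edist_le_one_iff_adj_or_eq.1 h with h | rfl
  · have h1 : (Γ.gen x)⁻¹ * (Γ.gen y)⁻¹ * Γ.gen x * Γ.gen y = 1 :=
      PresentedGroup.one_of_mem ⟨x, y, h, rfl⟩
    have h2 : ((Γ.gen y) * (Γ.gen x))⁻¹ * (Γ.gen x * Γ.gen y) = 1 := by
      rw [← h1]; group
    exact (inv_mul_eq_one.1 h2).symm
  · exact Commute.refl _

/-- The homomorphism from `G(Γ)` given by images of the vertices such that adjacent vertices have
commuting images. -/
def liftHom {G : Type*} [Group G] (f : X → G) (h : ∀ x y, Γ.Adj x y → Commute (f x) (f y)) :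
    Γ.PCGroup →* G :=
  PresentedGroup.toGroup (f := f) (by
    rintro _ ⟨x, y, hxy, rfl⟩
    simp only [map_mul, map_inv, FreeGroup.lift_apply_of]
    rw [mul_assoc, (h x y hxy).eq]
    group)

@[simp]
theorem liftHom_gen {G : Type*} [Group G] (f : X → G)
    (h : ∀ x y, Γ.Adj x y → Commute (f x) (f y)) (x : X) : Γ.liftHom f h (Γ.gen x) = f x :=
  PresentedGroup.toGroup.of _

theorem hom_ext {G : Type*} [Group G] {f g : Γ.PCGroup →* G}
    (h : ∀ x, f (Γ.gen x) = g (Γ.gen x)) : f = g :=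
  PresentedGroup.ext h

open Classical in
/-- The exponent sum of a vertex, as a homomorphism. -/
noncomputable def exponentHom (x : X) : Γ.PCGroup →* Multiplicative ℤ :=
  Γ.liftHom (fun y => Multiplicative.ofAdd (if y = x then 1 else 0)) fun _ _ _ => Commute.all _ _

/-- The exponent sum of a vertex `x` in an element of `G(Γ)`. -/
noncomputable def exponent (g : Γ.PCGroup) (x : X) : ℤ := (Γ.exponentHom x g).toAdd

@[simp]
theorem exponent_one (x : X) : Γ.exponent 1 x = 0 := by simp [exponent]

@[simp]
theorem exponent_mul (g h : Γ.PCGroup) (x : X) :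
    Γ.exponent (g * h) x = Γ.exponent g x + Γ.exponent h x := by simp [exponent]

@[simp]
theorem exponent_inv (g : Γ.PCGroup) (x : X) : Γ.exponent g⁻¹ x = -Γ.exponent g x := by
  simp [exponent]

open Classical in
theorem exponent_gen (x y : X) : Γ.exponent (Γ.gen y) x = if y = x then 1 else 0 := by
  simp [exponent, exponentHom]

theorem gen_mem_parabolic {Y : Set X} {x : X} (hx : x ∈ Y) : Γ.gen x ∈ Γ.parabolic Y :=
  Subgroup.subset_closure ⟨x, hx, rfl⟩

theorem mem_of_exponent_ne_zero {Y : Set X} {g : Γ.PCGroup} (hg : g ∈ Γ.parabolic Y) {x : X}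
    (hx : Γ.exponent g x ≠ 0) : x ∈ Y := by
  contrapose! hx
  induction hg using Subgroup.closure_induction with
  | mem _ h =>
    obtain ⟨y, hy, rfl⟩ := h
    rw [exponent_gen, if_neg]
    rintro rfl
    exact hx hy
  | one => simp
  | mul _ _ _ _ h1 h2 => simp [h1, h2]
  | inv _ _ h => simp [h]

theorem parabolic_mono {Y Z : Set X} (h : Y ⊆ Z) : Γ.parabolic Y ≤ Γ.parabolic Z :=
  Subgroup.closure_mono (Set.image_mono h)

/-- Non-trivial powers of the two standard unipotent matrices do not commute. -/
theorem _root_.ModularGroup.not_commute_T_zpow {p q : ℤ} (hp : p ≠ 0) (hq : q ≠ 0) :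
    ¬ Commute (ModularGroup.T ^ p)
      ((ModularGroup.S * ModularGroup.T * ModularGroup.S⁻¹) ^ q) := by
  intro h
  rw [conj_zpow] at h
  have h' := congrArg (fun g : SL(2, ℤ) => g.val 0 0) h.eq
  simp [ModularGroup.coe_T_zpow, ModularGroup.coe_S, Matrix.SpecialLinearGroup.coe_inv,
    Matrix.adjugate_fin_two, hp, hq] at h'

open Classical in
/-- If an element of `G(C)` and an element of `G(D)` commute, where `C` and `D` are cliques, then
the vertices that occur in one commute with those that occur in the other.  Otherwise two of
them, `u` and `v`, are not adjacent, and the two elements are mapped to non-commuting elements by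
the homomorphism to `SL(2, ℤ)` that sends `u` and `v` to the standard unipotent matrices and the
other vertices to `1`. -/
theorem edist_le_one_of_commute {C D : Set X} (hC : ∀ x ∈ C, ∀ y ∈ C, Γ.edist x y ≤ 1)
    (hD : ∀ x ∈ D, ∀ y ∈ D, Γ.edist x y ≤ 1) {g h : Γ.PCGroup} (hg : g ∈ Γ.parabolic C)
    (hh : h ∈ Γ.parabolic D) (hgh : Commute g h) {u v : X} (hu : Γ.exponent g u ≠ 0)
    (hv : Γ.exponent h v ≠ 0) : Γ.edist u v ≤ 1 := by
  have huC := Γ.mem_of_exponent_ne_zero hg hu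
  have hvD := Γ.mem_of_exponent_ne_zero hh hv
  by_contra huv
  have hvC : v ∉ C := fun h => huv (hC u huC v h)
  have huD : u ∉ D := fun h => huv (hD u h v hvD)
  have hne : u ≠ v := by rintro rfl; simp at huv
  have hadj : ¬ Γ.Adj u v := fun h => huv (edist_le_one_iff_adj_or_eq.2 (Or.inl h))
  let U : SL(2, ℤ) := ModularGroup.T
  let V : SL(2, ℤ) := ModularGroup.S * ModularGroup.T * ModularGroup.S⁻¹
  let f : X → SL(2, ℤ) := fun x => if x = u then U else if x = v then V else 1
  have hf : ∀ x y, Γ.Adj x y → Commute (f x) (f y) := by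
    intro x y hxy
    by_cases hxu : x = u
    · subst hxu
      have hyv : y ≠ v := by rintro rfl; exact hadj hxy
      simp [f, hxy.ne', hyv]
    by_cases hxv : x = v
    · subst hxv
      have hyu : y ≠ u := by rintro rfl; exact hadj hxy.symm
      simp [f, hxy.ne', hyu]
    simp [f, hxu, hxv]
  have hFg : Γ.liftHom f hf g = U ^ Γ.exponent g u := by
    clear hgh hu
    induction hg using Subgroup.closure_induction with
    | mem _ h =>
      obtain ⟨y, hy, rfl⟩ := h
      have : y ≠ v := by rintro rfl; exact hvC hy
      by_cases hyu : y = u <;> simp [exponent_gen, f, this, hyu]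
    | one => simp
    | mul _ _ _ _ h1 h2 => simp [h1, h2, zpow_add]
    | inv _ _ h => simp [h]
  have hFh : Γ.liftHom f hf h = V ^ Γ.exponent h v := by
    clear hgh hv
    induction hh using Subgroup.closure_induction with
    | mem _ h =>
      obtain ⟨y, hy, rfl⟩ := h
      have : y ≠ u := by rintro rfl; exact huD hy
      by_cases hyv : y = v
      · subst hyv; simp [exponent_gen, f, this]
      · simp [exponent_gen, f, this, hyv]
    | one => simp
    | mul _ _ _ _ h1 h2 => simp [h1, h2, zpow_add]
    | inv _ _ h => simp [h]
  have hc := hgh.map (Γ.liftHom f hf)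
  rw [hFg, hFh] at hc
  exact ModularGroup.not_commute_T_zpow hu hv hc

end Exponent

/-! ### Monomials -/

section Monomial

variable {X : Type*} (Γ : SimpleGraph X) {n : ℕ}

theorem _root_.List.prod_ofFn_mul_of_commute {M : Type*} [Monoid M] {n : ℕ} (f g : Fin n → M)
    (h : ∀ i j, Commute (f i) (g j)) :
    (List.ofFn fun i => f i * g i).prod = (List.ofFn f).prod * (List.ofFn g).prod := by
  induction n with
  | zero => simp
  | succ n ih =>
    have hc : Commute (List.ofFn fun i : Fin n => f i.succ).prod (g 0) := by
      refine Commute.list_prod_left _ _ fun x hx => ?_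
      obtain ⟨i, rfl⟩ := List.mem_ofFn.1 hx
      exact h _ _
    simp only [List.ofFn_succ, List.prod_cons]
    rw [ih _ _ fun i j => h i.succ j.succ]
    exact hc.symm.mul_mul_mul_comm _ _

theorem _root_.List.prod_ofFn_eq_of_ne {M : Type*} [Monoid M] {n : ℕ} (f : Fin n → M) (i : Fin n)
    (h : ∀ j, j ≠ i → f j = 1) : (List.ofFn f).prod = f i := by
  induction n with
  | zero => exact i.elim0
  | succ n ih =>
    rw [List.ofFn_succ, List.prod_cons]
    induction i using Fin.cases with
    | zero =>
      rw [List.prod_eq_one, mul_one]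
      intro x hx
      obtain ⟨j, rfl⟩ := List.mem_ofFn.1 hx
      exact h _ j.succ_ne_zero
    | succ i =>
      rw [h 0 i.succ_ne_zero.symm, one_mul]
      exact ih (fun j => f j.succ) i fun j hj => h _ (by simpa using hj)

/-- The product `x_1 ^ a_1 ⋯ x_n ^ a_n`. -/
def monomial (e : Fin n ≃ X) (a : Fin n → ℤ) : Γ.PCGroup :=
  (List.ofFn fun j => Γ.gen (e j) ^ a j).prod

variable (e : Fin n ≃ X)

theorem exponent_monomial (a : Fin n → ℤ) (j : Fin n) :
    Γ.exponent (Γ.monomial e a) (e j) = a j := by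
  have h (i : Fin n) : Γ.exponentHom (e j) (Γ.gen (e i)) =
      Multiplicative.ofAdd (if i = j then 1 else 0) := by
    simp [exponentHom]
  simp [exponent, monomial, map_list_prod, List.map_ofFn, List.prod_ofFn, Function.comp_def, h]

theorem monomial_zero : Γ.monomial e 0 = 1 := by
  simp [monomial, List.ofFn_const]

theorem commute_gen_zpow {x y : X} {p q : ℤ} (h : p ≠ 0 → q ≠ 0 → Γ.edist x y ≤ 1) :
    Commute (Γ.gen x ^ p) (Γ.gen y ^ q) := by
  by_cases hp : p = 0
  · simp [hp]
  by_cases hq : q = 0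
  · simp [hq]
  exact (Γ.commute_gen (h hp hq)).zpow_zpow p q

theorem monomial_add {a b : Fin n → ℤ}
    (h : ∀ i j, a i ≠ 0 → b j ≠ 0 → Γ.edist (e i) (e j) ≤ 1) :
    Γ.monomial e (a + b) = Γ.monomial e a * Γ.monomial e b := by
  simp only [monomial, Pi.add_apply, zpow_add]
  exact List.prod_ofFn_mul_of_commute _ _ fun i j => Γ.commute_gen_zpow (h i j)

theorem commute_monomial {a b : Fin n → ℤ}
    (h : ∀ i j, a i ≠ 0 → b j ≠ 0 → Γ.edist (e i) (e j) ≤ 1) :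
    Commute (Γ.monomial e a) (Γ.monomial e b) := by
  refine Commute.list_prod_left _ _ fun x hx => Commute.list_prod_right _ _ fun y hy => ?_
  obtain ⟨i, rfl⟩ := List.mem_ofFn.1 hx
  obtain ⟨j, rfl⟩ := List.mem_ofFn.1 hy
  exact Γ.commute_gen_zpow (h i j)

theorem monomial_mem_parabolic {a : Fin n → ℤ} {Y : Set X} (h : ∀ j, a j ≠ 0 → e j ∈ Y) :
    Γ.monomial e a ∈ Γ.parabolic Y := by
  refine Subgroup.list_prod_mem _ fun x hx => ?_
  obtain ⟨j, rfl⟩ := List.mem_ofFn.1 hx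
  by_cases hj : a j = 0
  · simp [hj]
  · exact Subgroup.zpow_mem _ (Γ.gen_mem_parabolic (h j hj)) _

open Classical in
theorem monomial_single (i : Fin n) (p : ℤ) :
    Γ.monomial e (Pi.single i p) = Γ.gen (e i) ^ p := by
  rw [monomial, List.prod_ofFn_eq_of_ne _ i fun j hj => by simp [hj], Pi.single_eq_same]

/-- An element of `G(C)`, where `C` is a clique, is determined by its exponents. -/
theorem monomial_exponent {C : Set X} (hC : ∀ x ∈ C, ∀ y ∈ C, Γ.edist x y ≤ 1)
    {g : Γ.PCGroup} (hg : g ∈ Γ.parabolic C) :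
    Γ.monomial e (fun j => Γ.exponent g (e j)) = g := by
  classical
  have key {g h : Γ.PCGroup} (hg : g ∈ Γ.parabolic C) (hh : h ∈ Γ.parabolic C) :
      Γ.monomial e (fun j => Γ.exponent (g * h) (e j)) =
        Γ.monomial e (fun j => Γ.exponent g (e j)) *
          Γ.monomial e (fun j => Γ.exponent h (e j)) := by
    rw [← monomial_add]
    · congr 1; ext j; simp
    · intro i j hi hj
      exact hC _ (Γ.mem_of_exponent_ne_zero hg hi) _ (Γ.mem_of_exponent_ne_zero hh hj)
  have hone : Γ.monomial e (fun j => Γ.exponent 1 (e j)) = 1 := by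
    simp only [exponent_one]
    exact Γ.monomial_zero e
  induction hg using Subgroup.closure_induction with
  | mem _ h =>
    obtain ⟨y, hy, rfl⟩ := h
    obtain ⟨i, rfl⟩ := e.surjective y
    have : (fun j => Γ.exponent (Γ.gen (e i)) (e j)) = Pi.single i 1 := by
      ext j
      simp [exponent_gen, Pi.single_apply, eq_comm]
    rw [this, monomial_single, zpow_one]
  | one => exact hone
  | mul _ _ h1 h2 ih1 ih2 => rw [key h1 h2, ih1, ih2]
  | inv g hg ih =>
    have := key hg (inv_mem hg)
    rw [mul_inv_cancel, hone, ih] at this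
    exact (inv_eq_of_mul_eq_one_right this.symm).symm

end Monomial

/-! ### The matrix of an endomorphism -/

section ExponentMatrix

variable {X : Type*} (Γ : SimpleGraph X) {n : ℕ} (e : Fin n ≃ X)

/-- The matrix whose `i`-th row consists of the exponent sums of the image of the `i`-th vertex:
the action on the abelianisation of `G(Γ)`, written on the right. -/
noncomputable def exponentMatrix (f : Γ.PCGroup →* Γ.PCGroup) : Matrix (Fin n) (Fin n) ℤ :=
  .of fun i j => Γ.exponent (f (Γ.gen (e i))) (e j)

theorem exponentMatrix_apply (f : Γ.PCGroup →* Γ.PCGroup) (i j : Fin n) :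
    Γ.exponentMatrix e f i j = Γ.exponent (f (Γ.gen (e i))) (e j) := rfl

theorem exponent_map (f : Γ.PCGroup →* Γ.PCGroup) (g : Γ.PCGroup) (j : Fin n) :
    Γ.exponent (f g) (e j) = ∑ i, Γ.exponent g (e i) * Γ.exponentMatrix e f i j := by
  let F : Γ.PCGroup →* Multiplicative ℤ := MonoidHom.mk'
    (fun g => .ofAdd (∑ i, Γ.exponent g (e i) * Γ.exponentMatrix e f i j))
    (fun a b => by simp only [exponent_mul, add_mul, Finset.sum_add_distrib, ofAdd_add])
  have h : (Γ.exponentHom (e j)).comp f = F := by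
    refine Γ.hom_ext fun x => ?_
    obtain ⟨i, rfl⟩ := e.surjective x
    change Multiplicative.ofAdd (Γ.exponent (f (Γ.gen (e i))) (e j)) = .ofAdd _
    simp [exponent_gen, exponentMatrix]
  exact congrArg Multiplicative.toAdd (DFunLike.congr_fun h g)

theorem exponentMatrix_comp (f g : Γ.PCGroup →* Γ.PCGroup) :
    Γ.exponentMatrix e (g.comp f) = Γ.exponentMatrix e f * Γ.exponentMatrix e g := by
  ext i j
  exact Γ.exponent_map e g (f (Γ.gen (e i))) j

theorem exponentMatrix_id : Γ.exponentMatrix e (MonoidHom.id _) = 1 := by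
  ext i j
  simp [exponentMatrix, exponent_gen, Matrix.one_apply]

/-- The action of `Aut(G(Γ))` on the abelianisation, as a homomorphism to `GL(n, ℤ)`. -/
noncomputable def autMatrix : Γ.RightAut →* GL (Fin n) ℤ :=
  MonoidHom.toHomUnits
    { toFun := fun φ => Γ.exponentMatrix e φ.unop.toMonoidHom
      map_one' := Γ.exponentMatrix_id e
      map_mul' := fun φ ψ => Γ.exponentMatrix_comp e φ.unop.toMonoidHom ψ.unop.toMonoidHom }

end ExponentMatrix

/-! ### Automorphisms that stabilise `L^max` -/

section Stabiliser

variable {X : Type*} (Γ : SimpleGraph X)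

theorem map_mem_parabolic (f : Γ.PCGroup →* Γ.PCGroup) {Y Z : Set X}
    (hf : ∀ x ∈ Y, f (Γ.gen x) ∈ Γ.parabolic Z) {g : Γ.PCGroup} (hg : g ∈ Γ.parabolic Y) :
    f g ∈ Γ.parabolic Z := by
  have : Γ.parabolic Y ≤ (Γ.parabolic Z).comap f := by
    rw [parabolic, Subgroup.closure_le]
    rintro _ ⟨x, hx, rfl⟩
    exact hf x hx
  exact this hg

theorem mem_stabiliser_iff {F : Set (Set X)} {φ : Γ.RightAut} :
    φ ∈ Γ.stabiliser F ↔ ∀ Y ∈ F, ∀ x ∈ Y,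
      φ.unop (Γ.gen x) ∈ Γ.parabolic Y ∧ φ⁻¹.unop (Γ.gen x) ∈ Γ.parabolic Y := by
  have key {ψ : Γ.RightAut} (hψ : ψ ∈ Γ.stabiliser F) {Y : Set X} (hY : Y ∈ F) {x : X}
      (hx : x ∈ Y) : ψ.unop (Γ.gen x) ∈ Γ.parabolic Y :=
    (hψ Y hY).le ⟨_, Γ.gen_mem_parabolic hx, rfl⟩
  refine ⟨fun h Y hY x hx => ⟨key h hY hx, key (inv_mem h) hY hx⟩, fun h Y hY => ?_⟩
  refine le_antisymm ?_ fun g hg => ⟨φ⁻¹.unop g, ?_, φ.unop.apply_symm_apply g⟩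
  · rintro _ ⟨g, hg, rfl⟩
    exact Γ.map_mem_parabolic φ.unop.toMonoidHom (fun x hx => (h Y hY x hx).1) hg
  · exact Γ.map_mem_parabolic φ⁻¹.unop.toMonoidHom (fun x hx => (h Y hY x hx).2) hg

theorem mem_stLMax_iff {φ : Γ.RightAut} :
    φ ∈ Γ.stLMax ↔ ∀ m, Γ.IsLMaximal m → ∀ x ∈ Γ.cl {m},
      φ.unop (Γ.gen x) ∈ Γ.parabolic (Γ.cl {m}) ∧
        φ⁻¹.unop (Γ.gen x) ∈ Γ.parabolic (Γ.cl {m}) := by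
  rw [stLMax, mem_stabiliser_iff]
  refine ⟨fun h m hm => h _ ⟨m, hm, rfl⟩, ?_⟩
  rintro h _ ⟨m, hm, rfl⟩
  exact h m hm

/-- A closed set is the union of the closures of its members, so that `St(L)` is the stabiliser
of the subgroups `G(cl(x))`. -/
theorem mem_stL_iff {φ : Γ.RightAut} :
    φ ∈ Γ.stL ↔ ∀ x, φ.unop (Γ.gen x) ∈ Γ.parabolic (Γ.cl {x}) ∧
      φ⁻¹.unop (Γ.gen x) ∈ Γ.parabolic (Γ.cl {x}) := by
  rw [stL, mem_stabiliser_iff]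
  refine ⟨fun h x => h _ (Γ.cl_mem_closedSets {x}) x (Γ.self_mem_cl x), fun h Y hY x hx => ?_⟩
  have hle : Γ.parabolic (Γ.cl {x}) ≤ Γ.parabolic Y := by
    refine Γ.parabolic_mono ?_
    rw [← show Γ.cl Y = Y from hY]
    exact Γ.cl_mono (Set.singleton_subset_iff.2 hx)
  exact ⟨hle (h x).1, hle (h x).2⟩

theorem stL_le_stLMax : Γ.stL ≤ Γ.stLMax := by
  rintro φ hφ _ ⟨m, -, rfl⟩
  exact hφ _ (Γ.cl_mem_closedSets _)

variable {n : ℕ} (e : Fin n ≃ X)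

theorem eq_monomial_exponent {m : X} {g : Γ.PCGroup} (hg : g ∈ Γ.parabolic (Γ.cl {m})) :
    g = Γ.monomial e fun j => Γ.exponent g (e j) :=
  (Γ.monomial_exponent e (fun _ hx _ hy => Γ.edist_le_one_of_mem_cl_singleton hx hy) hg).symm

theorem mem_parabolic_of_exponent {m : X} {g : Γ.PCGroup} (hg : g ∈ Γ.parabolic (Γ.cl {m}))
    {Y : Set X} (h : ∀ j, Γ.exponent g (e j) ≠ 0 → e j ∈ Y) : g ∈ Γ.parabolic Y := by
  rw [Γ.eq_monomial_exponent e hg]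
  exact Γ.monomial_mem_parabolic e h

/-- An automorphism in `St(L^max)` maps a vertex into some `G(C)` where `C` is a clique, so that the
image is the monomial whose exponents are the entries of a row of the matrix. -/
theorem apply_gen_eq_monomial {φ : Γ.RightAut} (hφ : φ ∈ Γ.stLMax) (i : Fin n) :
    φ.unop (Γ.gen (e i)) = Γ.monomial e ((Γ.autMatrix e φ).val i) := by
  have := Finite.of_equiv _ e
  obtain ⟨m, hm, him⟩ := Γ.exists_isLMaximal (e i)
  exact Γ.eq_monomial_exponent e (Γ.mem_stLMax_iff.1 hφ m hm _ him).1

theorem autMatrix_injOn_stLMax {φ ψ : Γ.RightAut} (hφ : φ ∈ Γ.stLMax) (hψ : ψ ∈ Γ.stLMax)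
    (h : Γ.autMatrix e φ = Γ.autMatrix e ψ) : φ = ψ := by
  have : φ.unop.toMonoidHom = ψ.unop.toMonoidHom := by
    refine Γ.hom_ext fun x => ?_
    obtain ⟨i, rfl⟩ := e.surjective x
    change φ.unop _ = ψ.unop _
    rw [Γ.apply_gen_eq_monomial e hφ, Γ.apply_gen_eq_monomial e hψ, h]
  exact MulOpposite.unop_injective (MulEquiv.toMonoidHom_injective this)

/-- The conditions on the positions of the non-zero entries of a matrix under which its rows are
the exponents of the images of the vertices under an endomorphism that maps every `G(Y)`,
`Y ∈ L^max`, to itself. -/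
structure IsCompatible {R : Type*} [Zero R] (A : Matrix (Fin n) (Fin n) R) : Prop where
  mem_maxHull : ∀ i j, A i j ≠ 0 → e j ∈ Γ.maxHull (e i)
  edist_le_one : ∀ i l, Γ.edist (e i) (e l) ≤ 1 → ∀ j k, A i j ≠ 0 → A l k ≠ 0 →
    Γ.edist (e j) (e k) ≤ 1

variable {Γ e}

theorem _root_.Matrix.exists_ne_zero_of_mul_apply_ne_zero {m R : Type*} [Fintype m]
    [NonUnitalNonAssocSemiring R] {A B : Matrix m m R} {i j : m} (h : (A * B) i j ≠ 0) :
    ∃ k, A i k ≠ 0 ∧ B k j ≠ 0 := by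
  obtain ⟨k, -, hk⟩ := Finset.exists_ne_zero_of_sum_ne_zero (Matrix.mul_apply (M := A) ▸ h)
  exact ⟨k, left_ne_zero_of_mul hk, right_ne_zero_of_mul hk⟩

theorem isCompatible_congr {R S : Type*} [Zero R] [Zero S] {A : Matrix (Fin n) (Fin n) R}
    {B : Matrix (Fin n) (Fin n) S} (h : ∀ i j, A i j ≠ 0 ↔ B i j ≠ 0) :
    Γ.IsCompatible e A ↔ Γ.IsCompatible e B :=
  ⟨fun hA => ⟨fun i j hj => hA.1 i j ((h _ _).2 hj),
      fun i l hil j k hj hk => hA.2 i l hil j k ((h _ _).2 hj) ((h _ _).2 hk)⟩,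
    fun hB => ⟨fun i j hj => hB.1 i j ((h _ _).1 hj),
      fun i l hil j k hj hk => hB.2 i l hil j k ((h _ _).1 hj) ((h _ _).1 hk)⟩⟩

theorem IsCompatible.one {R : Type*} [Semiring R] :
    Γ.IsCompatible e (1 : Matrix (Fin n) (Fin n) R) := by
  have key {i j : Fin n} (h : (1 : Matrix (Fin n) (Fin n) R) i j ≠ 0) : i = j := by
    by_contra hij
    exact h (Matrix.one_apply_ne hij)
  refine ⟨fun i j h => ?_, fun i l hil j k hj hk => ?_⟩
  · rw [key h]
    exact Γ.cl_subset_maxHull _ (Γ.self_mem_cl _)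
  · rwa [← key hj, ← key hk]

theorem IsCompatible.mul {R : Type*} [Semiring R] {A B : Matrix (Fin n) (Fin n) R}
    (hA : Γ.IsCompatible e A) (hB : Γ.IsCompatible e B) : Γ.IsCompatible e (A * B) := by
  refine ⟨fun i j h => ?_, fun i l hil j k hj hk => ?_⟩
  · obtain ⟨k, h1, h2⟩ := Matrix.exists_ne_zero_of_mul_apply_ne_zero h
    exact Γ.maxHull_trans (hA.1 _ _ h1) (hB.1 _ _ h2)
  · obtain ⟨p, h1, h2⟩ := Matrix.exists_ne_zero_of_mul_apply_ne_zero hj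
    obtain ⟨q, h3, h4⟩ := Matrix.exists_ne_zero_of_mul_apply_ne_zero hk
    exact hB.2 _ _ (hA.2 _ _ hil _ _ h1 h3) _ _ h2 h4

variable (Γ e) in
/-- The group of the invertible matrices `A` such that `A` and `A⁻¹` are compatible.  Over `ℂ` it
is the algebraic group of which `St(L^max)` is the group of integral points. -/
def compatibleSubgroup (R : Type*) [CommRing R] : Subgroup (GL (Fin n) R) where
  carrier := {A | Γ.IsCompatible e A.val ∧ Γ.IsCompatible e A⁻¹.val}
  one_mem' := by
    rw [Set.mem_ofPred_eq, inv_one, Units.val_one, and_self]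
    exact .one
  mul_mem' := by
    rintro A B ⟨hA, hA'⟩ ⟨hB, hB'⟩
    refine ⟨hA.mul hB, ?_⟩
    rw [mul_inv_rev]
    exact hB'.mul hA'
  inv_mem' := fun ⟨h, h'⟩ => ⟨h', by rwa [inv_inv]⟩

theorem mem_compatibleSubgroup {R : Type*} [CommRing R] {A : GL (Fin n) R} :
    A ∈ Γ.compatibleSubgroup e R ↔ Γ.IsCompatible e A.val ∧ Γ.IsCompatible e A⁻¹.val := Iff.rfl

/-- The images of two commuting vertices commute, and each of them lies in some `G(C)` where `C` is
a clique. -/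
theorem isCompatible_autMatrix {φ : Γ.RightAut} (hφ : φ ∈ Γ.stLMax) :
    Γ.IsCompatible e (Γ.autMatrix e φ).val := by
  have := Finite.of_equiv _ e
  have h := Γ.mem_stLMax_iff.1 hφ
  refine ⟨fun i j hij m hm hi => Γ.mem_of_exponent_ne_zero (h m hm _ hi).1 hij,
    fun i l hil j k hj hk => ?_⟩
  obtain ⟨m, hm, him⟩ := Γ.exists_isLMaximal (e i)
  obtain ⟨m', hm', hlm'⟩ := Γ.exists_isLMaximal (e l)
  exact Γ.edist_le_one_of_commute
    (fun _ hx _ hy => Γ.edist_le_one_of_mem_cl_singleton hx hy)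
    (fun _ hx _ hy => Γ.edist_le_one_of_mem_cl_singleton hx hy)
    (h m hm _ him).1 (h m' hm' _ hlm').1 ((Γ.commute_gen hil).map φ.unop) hj hk

/-- The endomorphism of `G(Γ)` given by a compatible integer matrix. -/
def IsCompatible.toHom {A : Matrix (Fin n) (Fin n) ℤ} (hA : Γ.IsCompatible e A) :
    Γ.PCGroup →* Γ.PCGroup :=
  Γ.liftHom (fun x => Γ.monomial e (A (e.symm x))) fun x y hxy =>
    Γ.commute_monomial e <| hA.edist_le_one _ _ <| by
      simpa using edist_le_one_iff_adj_or_eq.2 (Or.inl hxy)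

theorem IsCompatible.toHom_gen {A : Matrix (Fin n) (Fin n) ℤ} (hA : Γ.IsCompatible e A)
    (i : Fin n) : hA.toHom (Γ.gen (e i)) = Γ.monomial e (A i) := by
  simp [toHom]

theorem IsCompatible.toHom_gen_mem {A : Matrix (Fin n) (Fin n) ℤ} (hA : Γ.IsCompatible e A)
    {m : X} (hm : Γ.IsLMaximal m) {x : X} (hx : x ∈ Γ.cl {m}) :
    hA.toHom (Γ.gen x) ∈ Γ.parabolic (Γ.cl {m}) := by
  obtain ⟨i, rfl⟩ := e.surjective x
  rw [hA.toHom_gen]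
  exact Γ.monomial_mem_parabolic e fun j hj => hA.mem_maxHull i j hj m hm hx

theorem IsCompatible.exponentMatrix_toHom {A : Matrix (Fin n) (Fin n) ℤ}
    (hA : Γ.IsCompatible e A) : Γ.exponentMatrix e hA.toHom = A := by
  ext i j
  rw [exponentMatrix_apply, hA.toHom_gen, exponent_monomial]

theorem IsCompatible.toHom_comp {A B : Matrix (Fin n) (Fin n) ℤ} (hA : Γ.IsCompatible e A)
    (hB : Γ.IsCompatible e B) (h : A * B = 1) : hB.toHom.comp hA.toHom = MonoidHom.id _ := by
  have := Finite.of_equiv _ e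
  refine Γ.hom_ext fun x => ?_
  obtain ⟨i, rfl⟩ := e.surjective x
  obtain ⟨m, hm, him⟩ := Γ.exists_isLMaximal (e i)
  have hmem : hB.toHom (hA.toHom (Γ.gen (e i))) ∈ Γ.parabolic (Γ.cl {m}) :=
    Γ.map_mem_parabolic hB.toHom (fun x hx => hB.toHom_gen_mem hm hx)
      (hA.toHom_gen_mem hm him)
  have hmat : Γ.exponentMatrix e (hB.toHom.comp hA.toHom) =
      Γ.exponentMatrix e (MonoidHom.id _) := by
    rw [exponentMatrix_comp, hA.exponentMatrix_toHom, hB.exponentMatrix_toHom, h,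
      exponentMatrix_id]
  change hB.toHom (hA.toHom (Γ.gen (e i))) = Γ.gen (e i)
  calc _ = Γ.monomial e (Γ.exponentMatrix e (hB.toHom.comp hA.toHom) i) :=
        Γ.eq_monomial_exponent e hmem
    _ = Γ.monomial e (Γ.exponentMatrix e (MonoidHom.id _) i) := by rw [hmat]
    _ = _ := (Γ.eq_monomial_exponent e (Γ.gen_mem_parabolic him)).symm

variable (Γ e) in
/-- `St(L^max)` is identified with the group of the invertible integer matrices that are
compatible together with their inverses. -/
theorem map_autMatrix_stLMax : Γ.stLMax.map (Γ.autMatrix e) = Γ.compatibleSubgroup e ℤ := by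
  ext A
  constructor
  · rintro ⟨φ, hφ, rfl⟩
    refine ⟨isCompatible_autMatrix hφ, ?_⟩
    rw [← map_inv]
    exact isCompatible_autMatrix (inv_mem hφ)
  · rintro ⟨hA, hA'⟩
    refine ⟨.op (hA.toHom.toMulEquiv hA'.toHom
      (hA.toHom_comp hA' (by simp))
      (hA'.toHom_comp hA (by simp))), ?_, ?_⟩
    · exact Γ.mem_stLMax_iff.2 fun m hm x hx =>
        ⟨hA.toHom_gen_mem hm hx, hA'.toHom_gen_mem hm hx⟩
    · exact Units.ext hA.exponentMatrix_toHom

end Stabiliser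

/-! ### Arithmeticity -/

section Arithmetic

variable {X : Type*} (Γ : SimpleGraph X) {n : ℕ} (e : Fin n ≃ X)

theorem isCompatible_map_iff {R S : Type*} [CommRing R] [CommRing S] {f : R →+* S}
    (hf : Function.Injective f) {A : Matrix (Fin n) (Fin n) R} :
    Γ.IsCompatible e (A.map f) ↔ Γ.IsCompatible e A :=
  isCompatible_congr fun i j => by rw [Matrix.map_apply, Ne, map_eq_zero_iff f hf]

theorem map_mem_compatibleSubgroup_iff {R S : Type*} [CommRing R] [CommRing S] {f : R →+* S}
    (hf : Function.Injective f) {A : GL (Fin n) R} :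
    Matrix.GeneralLinearGroup.map f A ∈ Γ.compatibleSubgroup e S ↔
      A ∈ Γ.compatibleSubgroup e R := by
  rw [mem_compatibleSubgroup, mem_compatibleSubgroup, ← map_inv]
  exact and_congr (Γ.isCompatible_map_iff e hf) (Γ.isCompatible_map_iff e hf)

theorem isCompatible_inv_iff_adjugate {K : Type*} [Field K] {A : GL (Fin n) K} :
    Γ.IsCompatible e A⁻¹.val ↔ Γ.IsCompatible e A.val.adjugate := by
  have hdet : Ring.inverse A.val.det ≠ 0 := by
    rw [Ring.inverse_eq_inv']
    exact inv_ne_zero (Matrix.isUnit_iff_isUnit_det _ |>.1 A.isUnit).ne_zero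
  refine isCompatible_congr fun i j => ?_
  rw [Matrix.coe_units_inv, Matrix.inv_def, Matrix.smul_apply, smul_eq_mul, mul_ne_zero_iff]
  exact and_iff_right hdet

/-- The polynomials whose vanishing on a matrix expresses that it is compatible, where `M` is a
matrix of polynomials. -/
def compatibilityPolynomials {S : Type*} [CommRing S] (M : Matrix (Fin n) (Fin n) S) : Set S :=
  {p | ∃ i j, e j ∉ Γ.maxHull (e i) ∧ p = M i j} ∪
    {p | ∃ i l j k, Γ.edist (e i) (e l) ≤ 1 ∧ ¬ Γ.edist (e j) (e k) ≤ 1 ∧ p = M i j * M l k}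

theorem isCompatible_map_iff_polynomials {S K : Type*} [CommRing S] [Field K] (f : S →+* K)
    (M : Matrix (Fin n) (Fin n) S) :
    Γ.IsCompatible e (M.map f) ↔ ∀ p ∈ Γ.compatibilityPolynomials e M, f p = 0 := by
  constructor
  · rintro ⟨h1, h2⟩ _ (⟨i, j, hij, rfl⟩ | ⟨i, l, j, k, hil, hjk, rfl⟩)
    · by_contra h
      exact hij (h1 i j h)
    · rw [map_mul]
      by_contra h
      exact hjk (h2 i l hil j k (left_ne_zero_of_mul h) (right_ne_zero_of_mul h))
  · intro h
    refine ⟨fun i j hij => ?_, fun i l hil j k hj hk => ?_⟩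
    · by_contra hn
      exact hij (h _ (Or.inl ⟨i, j, hn, rfl⟩))
    · by_contra hn
      have := h _ (Or.inr ⟨i, l, j, k, hil, hn, rfl⟩)
      rw [map_mul] at this
      exact mul_ne_zero hj hk this

/-- The inverse of a matrix is a multiple of its adjugate, so that the compatibility of the
inverse is a polynomial condition. -/
theorem isRationallyDefined_compatibleSubgroup :
    IsRationallyDefined (Γ.compatibleSubgroup e ℂ) := by
  let M : Matrix (Fin n) (Fin n) (MvPolynomial (Fin n × Fin n) ℚ) :=
    Matrix.mvPolynomialX (Fin n) (Fin n) ℚ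
  refine ⟨Γ.compatibilityPolynomials e M ∪ Γ.compatibilityPolynomials e M.adjugate, fun A => ?_⟩
  let F : MvPolynomial (Fin n × Fin n) ℚ →+* ℂ :=
    (MvPolynomial.aeval fun ij : Fin n × Fin n => A.val ij.1 ij.2).toRingHom
  have hM : M.map F = A.val := Matrix.mvPolynomialX_mapMatrix_aeval ℚ A.val
  have hM' : M.adjugate.map F = A.val.adjugate := by
    rw [← hM]
    exact F.map_adjugate M
  have h1 := Γ.isCompatible_map_iff_polynomials e F M
  have h2 := Γ.isCompatible_map_iff_polynomials e F M.adjugate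
  rw [hM] at h1
  rw [hM'] at h2
  rw [mem_compatibleSubgroup, isCompatible_inv_iff_adjugate, h1, h2]
  simp only [Set.mem_union, or_imp, forall_and]
  rfl

theorem isArithmeticGroup_stLMax [Finite X] : IsArithmeticGroup Γ.stLMax := by
  obtain ⟨n, ⟨e⟩⟩ := Finite.exists_equiv_fin X
  replace e := e.symm
  let ι : GL (Fin n) ℤ →* GL (Fin n) ℂ := Matrix.GeneralLinearGroup.map (Int.castRingHom ℂ)
  have hι : Function.Injective ι :=
    Units.map_injective (Matrix.map_injective (RingHom.injective_int _))
  let f : Γ.stLMax →* GL (Fin n) ℂ := ι.comp ((Γ.autMatrix e).comp Γ.stLMax.subtype)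
  have hf : Function.Injective f := hι.comp fun φ ψ h =>
    Subtype.ext (Γ.autMatrix_injOn_stLMax e φ.2 ψ.2 h)
  have hrange : f.range = Γ.compatibleSubgroup e ℂ ⊓ integralPoints n := by
    have : f.range = (Γ.compatibleSubgroup e ℤ).map ι := by
      rw [← map_autMatrix_stLMax, MonoidHom.range_comp, MonoidHom.range_comp,
        Subgroup.range_subtype]
    rw [this]
    ext A
    constructor
    · rintro ⟨B, hB, rfl⟩
      exact ⟨(Γ.map_mem_compatibleSubgroup_iff e (RingHom.injective_int _)).2 hB, B, rfl⟩
    · rintro ⟨hA, B, rfl⟩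
      exact ⟨B, (Γ.map_mem_compatibleSubgroup_iff e (RingHom.injective_int _)).1 hA, rfl⟩
  refine ⟨n, Γ.compatibleSubgroup e ℂ, f.range, Γ.isRationallyDefined_compatibleSubgroup e,
    ⟨?_, ?_⟩, ⟨MonoidHom.ofInjective hf⟩⟩
  · rw [hrange]
    refine inf_le_inf_left _ ?_
    rintro _ ⟨B, rfl⟩
    exact ⟨Matrix.GeneralLinearGroup.map (Int.castRingHom ℚ) B, by ext; simp⟩
  · rw [hrange]

end Arithmetic

/-! ### Finite index -/

section FiniteIndex

theorem _root_.Subgroup.finiteIndex_of_map_finite {G α : Type*} [Group G] [Finite α]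
    (H : Subgroup G) (f : G → α) (h : ∀ a b, f a = f b → a⁻¹ * b ∈ H) : H.FiniteIndex := by
  have : Finite (G ⧸ H) := Finite.of_injective (fun q : G ⧸ H => f q.out) fun q r hqr => by
    rw [← q.out_eq', ← r.out_eq']
    exact QuotientGroup.eq.2 (h _ _ hqr)
  exact Subgroup.finiteIndex_of_finite_quotient

variable {X : Type*} (Γ : SimpleGraph X) {n : ℕ} (e : Fin n ≃ X)

/-- If the matrices of `φ` and `ψ` have their non-zero entries at the same places, then `φψ⁻¹`
maps a vertex `x` into `G(cl(x))`.  Let `y` occur in `φ(x)`, and let `v` commute with `x`.  Then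
`y` commutes with all vertices that occur in `φ(v)`; these also occur in `ψ(v)`, so that `y`
commutes with `ψ(v)`, and `ψ⁻¹(y)` commutes with `v`. -/
theorem inv_apply_apply_gen_mem {φ ψ : Γ.RightAut} (hφ : φ ∈ Γ.stLMax) (hψ : ψ ∈ Γ.stLMax)
    (h : ∀ i j, (Γ.autMatrix e ψ).val i j ≠ 0 → (Γ.autMatrix e φ).val i j ≠ 0) (x : X) :
    (φ * ψ⁻¹).unop (Γ.gen x) ∈ Γ.parabolic (Γ.cl {x}) := by
  have := Finite.of_equiv _ e
  obtain ⟨i, rfl⟩ := e.surjective x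
  obtain ⟨m, hm, him⟩ := Γ.exists_isLMaximal (e i)
  have hA := isCompatible_autMatrix (e := e) hφ
  have key : ∀ y ∈ {y | Γ.exponent (φ.unop (Γ.gen (e i))) y ≠ 0},
      ψ⁻¹.unop (Γ.gen y) ∈ Γ.parabolic (Γ.cl {e i}) := by
    intro y hy
    obtain ⟨j, rfl⟩ := e.surjective y
    have hjm := hA.mem_maxHull i j hy m hm him
    have hmem := (Γ.mem_stLMax_iff.1 hψ m hm _ hjm).2
    refine Γ.mem_parabolic_of_exponent e hmem fun k hk => Γ.mem_cl_singleton.2 fun v hv => ?_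
    obtain ⟨l, rfl⟩ := e.surjective v
    have hcomm : Commute (Γ.gen (e j)) (ψ.unop (Γ.gen (e l))) := by
      rw [Γ.apply_gen_eq_monomial e hψ, ← zpow_one (Γ.gen (e j)), ← monomial_single]
      refine Γ.commute_monomial e fun p q hp hq => ?_
      obtain rfl : p = j := by
        by_contra hpj
        simp [hpj] at hp
      exact hA.edist_le_one i l (by rwa [edist_comm]) _ _ hy (h _ _ hq)
    have hcomm' : Commute (ψ⁻¹.unop (Γ.gen (e j))) (Γ.gen (e l)) := by
      have := hcomm.map ψ⁻¹.unop
      rwa [show ψ⁻¹.unop (ψ.unop (Γ.gen (e l))) = Γ.gen (e l) from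
        ψ.unop.symm_apply_apply _] at this
    exact Γ.edist_le_one_of_commute
      (fun _ hx _ hy => Γ.edist_le_one_of_mem_cl_singleton hx hy)
      (fun _ hx _ hy => Γ.edist_le_one_of_mem_cl_singleton hx hy)
      hmem (Γ.gen_mem_parabolic (Γ.self_mem_cl (e l))) hcomm' hk (by simp [exponent_gen])
  have hsupp : φ.unop (Γ.gen (e i)) ∈
      Γ.parabolic {y | Γ.exponent (φ.unop (Γ.gen (e i))) y ≠ 0} :=
    Γ.mem_parabolic_of_exponent e (Γ.mem_stLMax_iff.1 hφ m hm _ him).1 fun _ hj => hj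
  exact Γ.map_mem_parabolic ψ⁻¹.unop.toMonoidHom key hsupp

theorem finiteIndex_stL_subgroupOf_stLMax [Finite X] :
    (Γ.stL.subgroupOf Γ.stLMax).FiniteIndex := by
  obtain ⟨n, ⟨e⟩⟩ := Finite.exists_equiv_fin X
  replace e := e.symm
  -- The membership `φ⁻¹ψ ∈ St(L)` that defines left cosets calls for the supports of the matrices
  -- of the inverses.
  refine Subgroup.finiteIndex_of_map_finite _
    (fun φ : Γ.stLMax => {p : Fin n × Fin n | (Γ.autMatrix e φ⁻¹.val).val p.1 p.2 ≠ 0})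
    fun φ ψ h => Subgroup.mem_subgroupOf.2 <| Γ.mem_stL_iff.2 fun x => ⟨?_, ?_⟩
  · have := Γ.inv_apply_apply_gen_mem e (φ⁻¹).2 (ψ⁻¹).2
      (fun i j hij => (Set.ext_iff.1 h (i, j)).2 hij) x
    simpa using this
  · have := Γ.inv_apply_apply_gen_mem e (ψ⁻¹).2 (φ⁻¹).2
      (fun i j hij => (Set.ext_iff.1 h (i, j)).1 hij) x
    simpa using this

end FiniteIndex

/-! ### The block matrices -/

section Blocks

variable {X : Type*} (Γ : SimpleGraph X) {n : ℕ} (e : Fin n ≃ X)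

/-- The inverse of a matrix whose `i`-th row is supported in `cl(x_i)` has the same property: for
fixed `x`, the matrix is block triangular with respect to `cl(x)` and its complement. -/
theorem inv_apply_mem_cl {R : Type*} [CommRing R] {A : GL (Fin n) R}
    (h : ∀ i j, A.val i j ≠ 0 → e j ∈ Γ.cl {e i}) (i j : Fin n) (hij : A⁻¹.val i j ≠ 0) :
    e j ∈ Γ.cl {e i} := by
  classical
  let b : Fin n → ℕ := fun l => if e l ∈ Γ.cl {e i} then 1 else 0
  have hb : A.val.BlockTriangular b := by
    intro p q hqp
    by_contra hpq
    have hp : e p ∈ Γ.cl {e i} := by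
      by_contra hp
      simp [b, hp] at hqp
    have hq : e q ∈ Γ.cl {e i} := Γ.cl_subset_of_mem hp (h _ _ hpq)
    simp [b, hp, hq] at hqp
  let := A.invertible
  have hinv := Matrix.blockTriangular_inv_of_blockTriangular hb
  rw [← Matrix.coe_units_inv] at hinv
  by_contra hj
  refine hij (hinv ?_)
  simp [b, hj, Γ.self_mem_cl]

open Classical in
/-- With respect to a linear extension of the inclusion of closures, a matrix whose `i`-th row is
supported in `cl(x_i)` is block triangular, with one diagonal block for each class of `∼`. -/
theorem isUnit_det_iff_blocks {R : Type*} [CommRing R] {A : Matrix (Fin n) (Fin n) R}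
    (h : ∀ i j, A i j ≠ 0 → e j ∈ Γ.cl {e i}) :
    IsUnit A.det ↔ ∀ x : X,
      IsUnit ((A.submatrix (fun i : {i // Γ.perpEquiv (e i) x} => i.val)
        (fun i : {i // Γ.perpEquiv (e i) x} => i.val)).det) := by
  let b : Fin n → (LinearExtension (Set X))ᵒᵈ := fun i =>
    OrderDual.toDual (toLinearExtension (Γ.cl {e i}))
  have hb : A.BlockTriangular b := by
    intro i j hij
    by_contra hA
    have : toLinearExtension (Γ.cl {e j}) ≤ toLinearExtension (Γ.cl {e i}) :=
      toLinearExtension.monotone (Γ.cl_subset_of_mem (h i j hA))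
    exact this.not_gt hij
  have hblock (i₀ : Fin n) : (A.toSquareBlock b (b i₀)).det =
      (A.submatrix (fun i : {i // Γ.perpEquiv (e i) (e i₀)} => i.val)
        (fun i : {i // Γ.perpEquiv (e i) (e i₀)} => i.val)).det := by
    have hp : (fun i => b i = b i₀) = fun i => Γ.perpEquiv (e i) (e i₀) := by
      ext i
      rw [perpEquiv_iff_cl_eq]
      exact Iff.rfl
    have key : ∀ p q : Fin n → Prop, p = q →
        (A.submatrix (fun i : {i // p i} => i.val) (fun i : {i // p i} => i.val)).det =
          (A.submatrix (fun i : {i // q i} => i.val) (fun i : {i // q i} => i.val)).det := by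
      rintro p _ rfl
      rfl
    convert key _ _ hp
    rfl
  rw [hb.det, IsUnit.prod_iff]
  constructor
  · intro hA x
    obtain ⟨i, rfl⟩ := e.surjective x
    rw [← hblock]
    exact hA _ (Finset.mem_image_of_mem _ (Finset.mem_univ i))
  · intro hA a ha
    obtain ⟨i, -, rfl⟩ := Finset.mem_image.1 ha
    rw [hblock]
    exact hA _

theorem isCompatible_of_mem_cl {R : Type*} [CommRing R] {A : Matrix (Fin n) (Fin n) R}
    (h : ∀ i j, A i j ≠ 0 → e j ∈ Γ.cl {e i}) : Γ.IsCompatible e A :=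
  ⟨fun i j hij => Γ.cl_subset_maxHull _ (h i j hij),
    fun _ _ hil _ _ hj hk => Γ.edist_le_one_of_mem_cl hil (h _ _ hj) (h _ _ hk)⟩

/-- The condition on `A` passes to `A⁻¹`, so it makes both compatible; hence `A` is the matrix of an
element of `St(L^max)`, which then stabilises every `G(cl(x))`. -/
theorem mem_map_autMatrix_stL_iff {A : GL (Fin n) ℤ} :
    A ∈ Γ.stL.map (Γ.autMatrix e) ↔ ∀ i j, A.val i j ≠ 0 → e j ∈ Γ.cl {e i} := by
  constructor
  · rintro ⟨φ, hφ, rfl⟩ i j hij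
    exact Γ.mem_of_exponent_ne_zero (Γ.mem_stL_iff.1 hφ (e i)).1 hij
  · intro hA
    have hA' := Γ.inv_apply_mem_cl e hA
    obtain ⟨φ, hφ, rfl⟩ : A ∈ Γ.stLMax.map (Γ.autMatrix e) := by
      rw [map_autMatrix_stLMax]
      exact ⟨Γ.isCompatible_of_mem_cl e hA, Γ.isCompatible_of_mem_cl e hA'⟩
    refine ⟨φ, Γ.mem_stL_iff.2 fun x => ?_, rfl⟩
    obtain ⟨i, rfl⟩ := e.surjective x
    rw [← map_inv] at hA'
    rw [Γ.apply_gen_eq_monomial e hφ, Γ.apply_gen_eq_monomial e (inv_mem hφ)]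
    exact ⟨Γ.monomial_mem_parabolic e (hA i), Γ.monomial_mem_parabolic e (hA' i)⟩

end Blocks

section Enumeration

variable {X : Type*} [Fintype X] (Γ : SimpleGraph X)

/-- The vertices are sorted by a linear extension of the reverse inclusion of their closures. -/
theorem exists_isAdmissible : ∃ e : Fin (Fintype.card X) ≃ X, Γ.IsAdmissible e := by
  let e₀ := (Fintype.equivFin X).symm
  let key : X → (LinearExtension (Set X))ᵒᵈ := fun x =>
    OrderDual.toDual (toLinearExtension (Γ.cl {x}))
  let e := (Tuple.sort (key ∘ e₀)).trans e₀
  have he : Monotone fun i => key (e i) := Tuple.monotone_sort (key ∘ e₀)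
  refine ⟨e, fun i j hij => ?_, fun i j k hij hjk hik => ?_⟩
  · by_contra! hle
    have h1 : toLinearExtension (Γ.cl {e j}) ≤ toLinearExtension (Γ.cl {e i}) := he hle
    have h2 : toLinearExtension (Γ.cl {e i}) ≤ toLinearExtension (Γ.cl {e j}) :=
      toLinearExtension.monotone hij.le
    exact hij.ne (h2.antisymm h1)
  · rw [perpEquiv_iff_cl_eq] at hik ⊢
    have h1 : toLinearExtension (Γ.cl {e k}) ≤ toLinearExtension (Γ.cl {e j}) := he hjk.le
    have h2 : toLinearExtension (Γ.cl {e j}) ≤ toLinearExtension (Γ.cl {e i}) := he hij.le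
    rw [hik] at h2
    exact h2.antisymm h1

variable {Γ}

/-- For an admissible enumeration, `x_j <_L x_i` implies `i < j`; the conditions on the entries off
the diagonal blocks therefore say that the `i`-th row is supported in `cl(x_i)`. -/
theorem IsAdmissible.mem_blockMatrices_iff {e : Fin (Fintype.card X) ≃ X} (he : Γ.IsAdmissible e)
    {A : Matrix (Fin (Fintype.card X)) (Fin (Fintype.card X)) ℤ} :
    A ∈ Γ.blockMatrices e ↔ IsUnit A.det ∧ ∀ i j, A i j ≠ 0 → e j ∈ Γ.cl {e i} := by
  constructor
  · rintro ⟨h1, h2, h3⟩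
    have hcl : ∀ i j, A i j ≠ 0 → e j ∈ Γ.cl {e i} := by
      intro i j hij
      rw [mem_cl_iff]
      by_contra! hn
      rcases lt_trichotomy j i with h | rfl | h
      · exact hij (h2 i j h hn.1)
      · exact hn.1 rfl
      · exact hij (h3 i j h hn.1 hn.2)
    exact ⟨(Γ.isUnit_det_iff_blocks e hcl).2 h1, hcl⟩
  · rintro ⟨h, hcl⟩
    refine ⟨(Γ.isUnit_det_iff_blocks e hcl).1 h, fun i j hji hn => ?_, fun i j _ hn hlt => ?_⟩
    · by_contra hij
      exact (he.lt_of_ltL j i ((Γ.mem_cl_iff.1 (hcl i j hij)).resolve_left hn)).not_gt hji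
    · by_contra hij
      exact hlt ((Γ.mem_cl_iff.1 (hcl i j hij)).resolve_left hn)

theorem IsAdmissible.image_map_autMatrix_stL {e : Fin (Fintype.card X) ≃ X}
    (he : Γ.IsAdmissible e) :
    (fun g : GL (Fin (Fintype.card X)) ℤ => g.val) ''
      (Γ.stL.map (Γ.autMatrix e) : Set (GL (Fin (Fintype.card X)) ℤ)) = Γ.blockMatrices e := by
  ext A
  rw [he.mem_blockMatrices_iff]
  constructor
  · rintro ⟨g, hg, rfl⟩
    exact ⟨(Matrix.isUnit_iff_isUnit_det _).1 g.isUnit, (Γ.mem_map_autMatrix_stL_iff e).1 hg⟩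
  · rintro ⟨hA, hcl⟩
    obtain ⟨g, rfl⟩ := (Matrix.isUnit_iff_isUnit_det _).2 hA
    exact ⟨g, (Γ.mem_map_autMatrix_stL_iff e).2 hcl, rfl⟩

end Enumeration

end SimpleGraph

theorem mainTheorem3 {X : Type*} [Fintype X] (Γ : SimpleGraph X) :
    IsArithmeticGroup Γ.stLMax ∧
    Γ.stL ≤ Γ.stLMax ∧
    (∃ e : Fin (Fintype.card X) ≃ X, Γ.IsAdmissible e) ∧
    ∀ e : Fin (Fintype.card X) ≃ X, Γ.IsAdmissible e →
      ∃ π : Γ.stLMax →* GL (Fin (Fintype.card X)) ℤ,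
        Function.Injective π ∧
        (∀ (φ : Γ.stLMax) (i : Fin (Fintype.card X)),
          φ.val.unop (Γ.gen (e i)) =
            (List.ofFn fun j => Γ.gen (e j) ^ ((π φ).val i j)).prod) ∧
        (fun g : GL (Fin (Fintype.card X)) ℤ => g.val) ''
            ((Γ.stL.subgroupOf Γ.stLMax).map π : Set (GL (Fin (Fintype.card X)) ℤ)) =
          Γ.blockMatrices e ∧
        ((Γ.stL.subgroupOf Γ.stLMax).map π).IsFiniteRelIndex π.range := by
  refine ⟨Γ.isArithmeticGroup_stLMax, Γ.stL_le_stLMax, Γ.exists_isAdmissible, fun e he => ?_⟩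
  have hinj : Function.Injective ((Γ.autMatrix e).comp Γ.stLMax.subtype) := fun φ ψ h =>
    Subtype.ext (Γ.autMatrix_injOn_stLMax e φ.2 ψ.2 h)
  refine ⟨_, hinj, fun φ i => Γ.apply_gen_eq_monomial e φ.2 i, ?_, ?_⟩
  · rw [← Subgroup.map_map, Subgroup.subgroupOf_map_subtype, inf_eq_left.2 Γ.stL_le_stLMax]
    exact he.image_map_autMatrix_stL
  · have := Γ.finiteIndex_stL_subgroupOf_stLMax
    rw [MonoidHom.range_eq_map]
    refine ⟨?_⟩
    rw [Subgroup.relIndex_map_map_of_injective _ _ hinj, Subgroup.relIndex_top_right]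
    exact Subgroup.FiniteIndex.index_ne_zero
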